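/- Derivative of Choice. For every computable metric space $X$, the derivative (jump) of closed choice on $X$ is strongly Weihrauch equivalent to the cluster point problem of $X$: $$\mathsf{C}_X' \equiv_{\mathrm{sW}} \mathsf{CL}_X .$$ Here the notions are as follows. A representation of a set $X$ is a partial surjective map $\delta:\subseteq\mathbb{N}^{\mathbb{N}}\to X$; if $\delta(p)=x$, then $p$ is called a name of $x$. A realizer of a partial multi-valued function $f:\subseteq (X,\delta_X)\rightrightarrows (Y,\delta_Y)$ is a partial function $F$ on $\mathbb{N}^{\mathbb{N}}$ such that $\delta_Y F(p)$ is defined and lies in $f(\delta_X(p))$ for all $p\in\mathrm{dom}(f\delta_X)$. One writes $f\le_{\mathrm{sW}} g$ if there are computable partial functions $K,H$ on $\mathbb{N}^{\mathbb{N}}$ such that $K G H$ is a realizer of $f$ for every realizer $G$ of $g$, and $f\equiv_{\mathrm{sW}}g$ if $f\le_{\mathrm{sW}}g$ and $g\le_{\mathrm{sW}}f$. The derivative $f'$ is the same multi-valued function as $f$, with the input representation $\delta_X$ replaced by $\delta_X'=\delta_X\circ\lim$, where $\lim\langle p_0,p_1,p_2,\dots\rangle=\lim_{i\to\infty}p_i$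 in $\mathbb{N}^{\mathbb{N}}$ and $\langle p_0,p_1,\dots\rangle\langle i,j\rangle=p_i(j)$. A computable metric space is a triple $(X,d,\alpha)$ where $(X,d)$ is a metric space, $\alpha:\mathbb{N}\to X$ has dense range, and $(d(\alpha(i),\alpha(j)))_{i,j}$ is a computable double sequence of reals. Points of $X$ are represented by the Cauchy representation: $p$ is a name of $x$ if $\lim_n\alpha(p(n))=x$ and $d(\alpha(p(n)),\alpha(p(k)))<2^{-n}$ for all $k>n$. Sequences in $X^{\mathbb{N}}$ are represented componentwise: $\langle p_0,p_1,\dots\rangle$ is a name of $(x_n)$ if each $p_n$ is a name of $x_n$. A closed set $A\subseteq X$ is represented by negative information: $p$ is a name of $A$ if $A=X\setminus\bigcup_i B_{p(i)}$, where $B_{\langle n,k\rangle}$ is the open ball around $\alpha(n)$ whose radius is the $k$-th rational number. The problem $\mathsf{C}_X$ maps a nonempty closed set $A$, given by negative information, to any of its points. The problem $\mathsf{CL}_X$ maps a sequence in $X$ that has at least one cluster point to any of its cluster points. -/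

import Mathlib

open Filter Topology

namespace Weihrauch

/-- Baire space `ℕ^ℕ`, with the product of the discrete topologies. -/
abbrev Baire : Type := ℕ → ℕ

/-- The finite initial segment of length `m` of a point of Baire space. -/
def initialSegment (p : Baire) (m : ℕ) : List ℕ := (List.range m).map p

/-- A partial function on Baire space is computable if some Type-2 machine, given a point `p` of the
domain as input, writes the infinite sequence `F p` on its one-way output tape. The machine is
presented by the computable map `φ`, monotone for the prefix order, that sends a finite piece
of the input to the finite piece of the output which is produced from it. -/
def IsComputable (F : Baire →. Baire) : Prop :=
  ∃ φ : List ℕ → List ℕ, Computable φ ∧ (∀ u v, u <+: v → φ u <+: φ v) ∧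
    ∀ p q, q ∈ F p → ∀ n, ∃ m, (φ (initialSegment p m))[n]? = some (q n)

/-- A representation of `X`: a partial surjective function from Baire space to `X`, given by its
graph. `IsName p x` says that `p` lies in the domain and is mapped to `x`. -/
structure Representation (X : Type*) where
  IsName : Baire → X → Prop
  functional : ∀ {p x y}, IsName p x → IsName p y → x = y
  surjective : ∀ x, ∃ p, IsName p x

/-- The `i`-th component `p_i` of `p = ⟨p_0, p_1, p_2, …⟩`, where
`⟨p_0, p_1, p_2, …⟩⟨i, j⟩ = p_i(j)`. -/
def component (p : Baire) (i : ℕ) : Baire := fun j => p (Nat.pair i j)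

/-- The inverse of `component`: the sequence `⟨p_0, p_1, p_2, …⟩`. -/
def tuple (p : ℕ → Baire) : Baire := fun n => p n.unpair.1 n.unpair.2

@[simp] theorem component_tuple (p : ℕ → Baire) (i : ℕ) : component (tuple p) i = p i := by
  funext j
  simp [component, tuple]

/-- The graph of `lim`, which maps `⟨p_0, p_1, p_2, …⟩` to the limit of `(p_i)` in Baire space,
provided that this limit exists. -/
def IsLim (p q : Baire) : Prop := Tendsto (component p) atTop (𝓝 q)

/-- The jump `δ' = δ ∘ lim` of a representation `δ`. -/
def Representation.jump {X : Type*} (δ : Representation X) : Representation X where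
  IsName p x := ∃ q, IsLim p q ∧ δ.IsName q x
  functional := by
    rintro p x y ⟨q, hq, hx⟩ ⟨r, hr, hy⟩
    obtain rfl : q = r := tendsto_nhds_unique hq hr
    exact δ.functional hx hy
  surjective x := by
    obtain ⟨q, hq⟩ := δ.surjective x
    refine ⟨tuple fun _ => q, q, ?_, hq⟩
    have h : component (tuple fun _ => q) = fun _ => q := funext fun i => by simp
    rw [IsLim, h]
    exact tendsto_const_nhds

/-- The representation of `X^ℕ` for which `⟨p_0, p_1, p_2, …⟩` is a name of `(x_n)` if each `p_n`
is a name of `x_n`. -/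
def Representation.sequences {X : Type*} (δ : Representation X) : Representation (ℕ → X) where
  IsName p x := ∀ n, δ.IsName (component p n) (x n)
  functional hx hy := funext fun n => δ.functional (hx n) (hy n)
  surjective x := by
    choose p hp using fun n => δ.surjective (x n)
    exact ⟨tuple p, fun n => by simpa using hp n⟩

/-- A partial multi-valued function between represented spaces. The domain of the underlying map
`toFun` is the set of those `x` for which `toFun x` is nonempty. -/
structure Problem (X Y : Type*) where
  inRep : Representation X
  outRep : Representation Y
  toFun : X → Set Y

/-- The derivative (or jump) of a problem: the same multi-valued function, with the representation
of the input space replaced by its jump. -/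
def Problem.jump {X Y : Type*} (f : Problem X Y) : Problem X Y :=
  { f with inRep := f.inRep.jump }

/-- `F` is a realizer of `f`: for every name `p` of a point `x` in the domain of `f`, the value
`F p` is defined and is a name of a point of `f x`. -/
def Problem.Realizes {X Y : Type*} (F : Baire →. Baire) (f : Problem X Y) : Prop :=
  ∀ p x, f.inRep.IsName p x → (f.toFun x).Nonempty →
    ∃ q ∈ F p, ∃ y ∈ f.toFun x, f.outRep.IsName q y

/-- Strong Weihrauch reducibility: there are computable `K`, `H` such that `K ∘ G ∘ H` is a realizer
of `f` whenever `G` is a realizer of `g`. -/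
def StrongReducible {X Y Z W : Type*} (f : Problem X Y) (g : Problem Z W) : Prop :=
  ∃ K H : Baire →. Baire, IsComputable K ∧ IsComputable H ∧
    ∀ G : Baire →. Baire, g.Realizes G → f.Realizes (K.comp (G.comp H))

/-- Strong Weihrauch equivalence. -/
def StrongEquivalent {X Y Z W : Type*} (f : Problem X Y) (g : Problem Z W) : Prop :=
  StrongReducible f g ∧ StrongReducible g f

/-- A standard numbering of the rational numbers: `⟨⟨a, b⟩, c⟩` is a code of `(a - b) / (c + 1)`. -/
def ratOf (k : ℕ) : ℚ :=
  ((k.unpair.1.unpair.1 : ℚ) - (k.unpair.1.unpair.2 : ℚ)) / ((k.unpair.2 : ℚ) + 1)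

theorem ratOf_surjective : Function.Surjective ratOf := by
  intro q
  refine ⟨Nat.pair (Nat.pair q.num.toNat (-q.num).toNat) (q.den - 1), ?_⟩
  have h1 : ((q.num.toNat : ℚ)) - ((-q.num).toNat : ℚ) = (q.num : ℚ) := by
    exact_mod_cast Int.toNat_sub_toNat_neg q.num
  have h2 : (((q.den - 1 : ℕ) : ℚ)) + 1 = (q.den : ℚ) := by
    have := q.pos
    exact_mod_cast Nat.sub_add_cancel this
  simp only [ratOf, Nat.unpair_pair]
  rw [h1, h2, Rat.num_div_den]

/-- A computable metric space `(X, d, α)`: a sequence `α` that is dense in the metric space `X` and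
for which `d(α(i), α(j))` is a computable (double) sequence of real numbers, that is, rational
approximations up to `2^{-k}` can be computed from `i`, `j`, `k`. -/
structure ComputableMetricSpace (X : Type*) [MetricSpace X] where
  α : ℕ → X
  dense : DenseRange α
  computable_dist : ∃ f : ℕ × ℕ × ℕ → ℕ, Computable f ∧
    ∀ i j k, |dist (α i) (α j) - (ratOf (f (i, j, k)) : ℝ)| ≤ (1 / 2 : ℝ) ^ k

namespace ComputableMetricSpace

variable {X : Type*} [MetricSpace X] (M : ComputableMetricSpace X)

/-- The Cauchy representation: `p` is a name of `x` if `α(p(n))` converges to `x` and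
`d(α(p(n)), α(p(k))) < 2^{-n}` for all `k > n`. -/
def cauchyRep : Representation X where
  IsName p x := (∀ n k, n < k → dist (M.α (p n)) (M.α (p k)) < (1 / 2 : ℝ) ^ n) ∧
    Tendsto (fun n => M.α (p n)) atTop (𝓝 x)
  functional hx hy := tendsto_nhds_unique hx.2 hy.2
  surjective x := by
    have hpos : ∀ n : ℕ, 0 < (1 / 2 : ℝ) ^ (n + 1) := fun n => by positivity
    choose p hp using fun n : ℕ => M.dense.exists_dist_lt x (hpos n)
    refine ⟨p, fun n k hnk => ?_, ?_⟩
    · have h1 : (1 / 2 : ℝ) ^ (k + 1) ≤ (1 / 2 : ℝ) ^ (n + 1) :=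
        pow_le_pow_of_le_one (by norm_num) (by norm_num) (by omega)
      have h2 : (1 / 2 : ℝ) ^ (n + 1) + (1 / 2 : ℝ) ^ (n + 1) = (1 / 2 : ℝ) ^ n := by ring
      have h3 := dist_triangle_left (M.α (p n)) (M.α (p k)) x
      linarith [hp n, hp k]
    · rw [tendsto_iff_dist_tendsto_zero]
      have h0 : Tendsto (fun n : ℕ => (1 / 2 : ℝ) ^ (n + 1)) atTop (𝓝 0) :=
        (tendsto_pow_atTop_nhds_zero_of_lt_one (by norm_num) (by norm_num)).comp
          (tendsto_add_atTop_nat 1)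
      refine squeeze_zero (fun _ => dist_nonneg) (fun n => ?_) h0
      rw [dist_comm]
      exact (hp n).le

/-- The numbering of the open rational balls: `B_⟨n, k⟩` is the ball around `α(n)` whose radius is the
`k`-th rational number. It is empty if that number is not positive. -/
def ratBall (i : ℕ) : Set X := Metric.ball (M.α i.unpair.1) (ratOf i.unpair.2 : ℝ)

theorem exists_ratBall {U : Set X} (hU : IsOpen U) {x : X} (hx : x ∈ U) :
    ∃ i, x ∈ M.ratBall i ∧ M.ratBall i ⊆ U := by
  obtain ⟨ε, hε, hεU⟩ := Metric.isOpen_iff.1 hU x hx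
  obtain ⟨n, hn⟩ := M.dense.exists_dist_lt x (half_pos hε)
  obtain ⟨r, hr1, hr2⟩ := exists_rat_btwn hn
  obtain ⟨k, rfl⟩ := ratOf_surjective r
  refine ⟨Nat.pair n k, ?_, fun y hy => hεU ?_⟩
  · simpa [ratBall] using hr1
  · simp only [ratBall, Nat.unpair_pair, Metric.mem_ball] at hy ⊢
    have := dist_triangle_right y x (M.α n)
    linarith

/-- The negative information representation `ψ₋` of the closed subsets of `X`: `p` is a name of
`X \ ⋃ i, B_{p(i)}`. It is total. -/
def negRep : Representation (TopologicalSpace.Closeds X) where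
  IsName p A := (A : Set X) = (⋃ i, M.ratBall (p i))ᶜ
  functional hA hB := SetLike.coe_injective (hA.trans hB.symm)
  surjective A := by
    have hne : {i | M.ratBall i ⊆ (A : Set X)ᶜ}.Nonempty := by
      obtain ⟨k, hk⟩ := ratOf_surjective 0
      exact ⟨Nat.pair 0 k, by simp [ratBall, hk]⟩
    obtain ⟨p, hp⟩ := (Set.to_countable {i | M.ratBall i ⊆ (A : Set X)ᶜ}).exists_eq_range hne
    refine ⟨p, ?_⟩
    rw [eq_compl_comm]
    refine Set.Subset.antisymm (Set.iUnion_subset fun i => ?_) fun x hx => ?_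
    · have h : p i ∈ {i | M.ratBall i ⊆ (A : Set X)ᶜ} := hp ▸ Set.mem_range_self i
      exact h
    · obtain ⟨i, hxi, hi⟩ := M.exists_ratBall A.isClosed.isOpen_compl hx
      have h : i ∈ Set.range p := hp ▸ hi
      obtain ⟨j, rfl⟩ := h
      exact Set.mem_iUnion.2 ⟨j, hxi⟩

/-- Closed choice `C_X`: given a nonempty closed set by negative information, find a point of it. -/
def closedChoice : Problem (TopologicalSpace.Closeds X) X where
  inRep := M.negRep
  outRep := M.cauchyRep
  toFun A := A

/-- The map `L_X`, which sends a sequence to the closed set of its cluster points. -/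
def clusterSet {X : Type*} [TopologicalSpace X] (u : ℕ → X) : TopologicalSpace.Closeds X where
  carrier := {x | MapClusterPt x atTop u}
  isClosed' := isClosed_setOfPred_clusterPt

/-- The cluster point problem `CL_X = C_X ∘ L_X`: given a sequence that has a cluster point, find a
cluster point of it. -/
def clusterPointProblem : Problem (ℕ → X) X where
  inRep := M.cauchyRep.sequences
  outRep := M.cauchyRep
  toFun := M.closedChoice.toFun ∘ clusterSet

end ComputableMetricSpace

end Weihrauch

/-! Both reductions translate names by a total computable function and leave solutions unchanged, so
the outer functional is the identity.

From cluster points to choice: `x` is a cluster point of `(x_m)` iff it lies in no rational ball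
that some tail of the sequence avoids. That the tail from `N` on meets the ball `c` is
semidecidable, so announcing `c` until a hit is found, and the empty ball from then on, converges to
negative information about the cluster set (`isName_clusterSet`).

From choice to cluster points: let the stages of `p` converge to a list `q` of balls with nonempty
common complement `A`. For each `k` fix a `2^{-k}`-net of the dense sequence. The net point `n` is
listed at stage `n + k`, and again at each later stage that alters one of the first `k + 1` balls,
provided that it avoids these balls up to a multiple of `2^{-k}`. Points of `A` are approximated by
listed points at every precision (`exists_listed`). A point of some ball of `q` has a neighbourhood
with only finitely many listings (`exists_bound_of_mem_ratBall`): at high precision the test fails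
once the stages have settled, and at each of the finitely many low precisions separation leaves at
most one net point nearby, which is relisted only finitely often. Thus the cluster points of the
listing are exactly the points of `A`. -/

namespace Weihrauch

/-! ### Bounded search, recursion and computable functions on Baire space -/

section Computability

variable {α σ : Type*} [Primcodable α] [Primcodable σ]

theorem computable_map_range {f : α → ℕ} {g : α → ℕ → σ} (hf : Computable f)
    (hg : Computable₂ g) : Computable fun a => (List.range (f a)).map (g a) := by
  have h : Computable₂ fun (a : α) (s : ℕ × List σ) => s.2 ++ [g a s.1] :=
    Computable.list_concat.comp (Computable.snd.comp Computable.snd)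
      (hg.comp Computable.fst (Computable.fst.comp Computable.snd))
  refine (Computable.nat_rec hf (Computable.const []) h).of_eq fun a => ?_
  induction f a with
  | zero => rfl
  | succ n ih => simp only [ih, List.range_succ, List.map_append, List.map_cons, List.map_nil]

theorem computable_all_range {f : α → ℕ} {g : α → ℕ → Bool} (hf : Computable f)
    (hg : Computable₂ g) : Computable fun a => (List.range (f a)).all (g a) := by
  have h : Computable₂ fun (a : α) (s : ℕ × Bool) => s.2 && g a s.1 :=
    Primrec.and.to_comp.comp (Computable.snd.comp Computable.snd)
      (hg.comp Computable.fst (Computable.fst.comp Computable.snd))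
  refine (Computable.nat_rec hf (Computable.const true) h).of_eq fun a => ?_
  induction f a with
  | zero => rfl
  | succ n ih => simp only [ih, List.range_succ, List.all_append, List.all_cons, List.all_nil,
      Bool.and_true]

theorem computable_any_range {f : α → ℕ} {g : α → ℕ → Bool} (hf : Computable f)
    (hg : Computable₂ g) : Computable fun a => (List.range (f a)).any (g a) := by
  have h := Primrec.not.to_comp.comp
    (computable_all_range hf (g := fun a n => !g a n) (Primrec.not.to_comp.comp hg))
  refine h.of_eq fun a => ?_
  simp [List.any_eq_not_all_not]

/-- The greedy selection of natural numbers of which no two are in the relation `c`. -/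
def greedy (c : ℕ → ℕ → Bool) (n : ℕ) : Bool :=
  decide (∀ m : Fin n, greedy c m = true → c n m = false)
termination_by n
decreasing_by all_goals exact Fin.is_lt _

theorem greedy_iff (c : ℕ → ℕ → Bool) (n : ℕ) :
    greedy c n = true ↔ ∀ m < n, greedy c m = true → c n m = false := by
  rw [greedy, decide_eq_true_iff]
  exact ⟨fun h m hm => h ⟨m, hm⟩, fun h m => h m m.2⟩

theorem computable_greedy {c : α → ℕ → ℕ → Bool}
    (hc : Computable fun s : α × ℕ × ℕ => c s.1 s.2.1 s.2.2) :
    Computable₂ fun a => greedy (c a) := by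
  -- Course-of-values recursion: `l` holds the decisions made so far, so its length is the number
  -- now being decided.
  let g : α → List Bool → Option Bool := fun a l =>
    some ((List.range l.length).all fun m => !(l[m]?.getD false && c a l.length m))
  have hl : Computable fun s : (α × List Bool) × ℕ => s.1.2 :=
    Computable.snd.comp Computable.fst
  have hg : Computable₂ g := by
    refine Computable.option_some.comp (computable_all_range
      (Computable.list_length.comp Computable.snd)
      (g := fun (s : α × List Bool) m => !(s.2[m]?.getD false && c s.1 s.2.length m)) ?_)
    refine Primrec.not.to_comp.comp (Primrec.and.to_comp.comp
      (Computable.option_getD (Computable.list_getElem?.comp hl Computable.snd)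
        (Computable.const false)) ?_)
    exact hc.comp (Computable.pair (Computable.fst.comp Computable.fst)
      (Computable.pair (Computable.list_length.comp hl) Computable.snd))
  refine Computable.nat_strong_rec _ hg fun a n => ?_
  simp only [g, Option.some.injEq]
  rw [Bool.eq_iff_iff, greedy_iff]
  simp only [List.all_eq_true, List.mem_range, List.length_map, List.length_range]
  refine forall₂_congr fun m hm => ?_
  simp only [List.getElem?_map, List.getElem?_range hm, Option.map_some, Option.getD_some]
  cases greedy (c a) m <;> cases c a n m <;> simp

/-- The value of a function given by recursion along a stream of updates: the last `v t'` with
`t' ≤ t` and `P t'`, and `0` if there is none. -/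
def lastValue (P : ℕ → Bool) (v : ℕ → ℕ) (t : ℕ) : ℕ :=
  Nat.rec 0 (fun s x => bif P s then v s else x) (t + 1)

theorem lastValue_of_eq_true {P : ℕ → Bool} {v : ℕ → ℕ} {t : ℕ} (h : P t = true) :
    lastValue P v t = v t := by
  simp [lastValue, h]

/-- Once an update has occurred, the default `0` is never seen again and no value older than that
update survives. -/
theorem exists_lastValue_eq {P : ℕ → Bool} {v : ℕ → ℕ} {s t : ℕ} (hs : P s = true)
    (hst : s ≤ t) : ∃ t', s ≤ t' ∧ P t' = true ∧ lastValue P v t = v t' := by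
  induction t, hst using Nat.le_induction with
  | base => exact ⟨s, le_rfl, hs, lastValue_of_eq_true hs⟩
  | succ t hst ih =>
    cases h : P (t + 1) with
    | true => exact ⟨t + 1, by omega, h, lastValue_of_eq_true h⟩
    | false =>
      obtain ⟨t', h1, h2, h3⟩ := ih
      refine ⟨t', h1, h2, ?_⟩
      rw [← h3]
      simp [lastValue, h]

theorem lastValue_congr {P Q : ℕ → Bool} {v : ℕ → ℕ} {t : ℕ} (h : ∀ s ≤ t, P s = Q s) :
    lastValue P v t = lastValue Q v t := by
  unfold lastValue
  have h' : ∀ s < t + 1, P s = Q s := fun s hs => h s (by omega)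
  generalize t + 1 = n at h'
  induction n with
  | zero => rfl
  | succ n ih => simp only [h' n (by omega), ih fun s hs => h' s (by omega)]

theorem computable_lastValue {P : α → ℕ → Bool} {v : ℕ → ℕ} (hP : Computable₂ P)
    (hv : Computable v) : Computable₂ fun a => lastValue (P a) v := by
  have h : Computable₂ fun (a : α × ℕ) (s : ℕ × ℕ) => bif P a.1 s.1 then v s.1 else s.2 :=
    Computable.cond
      (hP.comp (Computable.fst.comp Computable.fst) (Computable.fst.comp Computable.snd))
      (hv.comp (Computable.fst.comp Computable.snd)) (Computable.snd.comp Computable.snd)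
  exact Computable.nat_rec (Computable.succ.comp Computable.snd) (Computable.const 0) h

/-- A total function on Baire space is computable if finitely much of the input, with an
explicit bound, suffices to compute each value of the output. -/
theorem isComputable_of_local {h : Baire → Baire}
    (hc : Computable₂ fun (u : List ℕ) n => h (fun j => u[j]?.getD 0) n)
    (hl : ∀ p p' n, (∀ j < (n + 1) ^ 2, p j = p' j) → h p n = h p' n) :
    IsComputable (PFun.lift h) := by
  -- The value at `n` is emitted only when `(n + 1) ^ 2` inputs are present, so the zero padding
  -- never influences an output and the outputs are monotone.
  refine ⟨fun u => (List.range u.length.sqrt).map (h fun j => u[j]?.getD 0),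
    computable_map_range (Primrec.nat_sqrt.to_comp.comp Computable.list_length) hc, ?_, ?_⟩
  · rintro u _ ⟨w, rfl⟩
    have hle : u.length.sqrt ≤ (u ++ w).length.sqrt := Nat.sqrt_le_sqrt (by simp)
    beta_reduce
    rw [show (List.range u.length.sqrt).map (h fun j => u[j]?.getD 0) =
        (List.range u.length.sqrt).map (h fun j => (u ++ w)[j]?.getD 0) from
      List.map_congr_left fun n hn => hl _ _ _ fun j hj => ?_]
    · obtain ⟨d, hd⟩ := Nat.exists_eq_add_of_le hle
      rw [hd, List.range_add, List.map_append]
      exact List.prefix_append _ _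
    · have h1 : (n + 1) ^ 2 ≤ u.length :=
        Nat.le_sqrt'.1 (Nat.succ_le_of_lt (List.mem_range.1 hn))
      rw [List.getElem?_append_left (hj.trans_le h1)]
  · intro p q hq n
    obtain rfl := Part.mem_some_iff.1 hq
    refine ⟨(n + 1) ^ 2, ?_⟩
    have hlen : (initialSegment p ((n + 1) ^ 2)).length = (n + 1) ^ 2 := by simp [initialSegment]
    beta_reduce
    rw [hlen, Nat.sqrt_eq', List.getElem?_map, List.getElem?_range (Nat.lt_succ_self n)]
    refine congrArg some (hl _ _ _ fun j hj => ?_)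
    simp [initialSegment, List.getElem?_range hj]

theorem isComputable_id : IsComputable (PFun.id Baire) := by
  refine ⟨id, Computable.id, fun _ _ => id, fun p q hq n => ⟨n + 1, ?_⟩⟩
  obtain rfl := Part.mem_some_iff.1 hq
  simp [initialSegment]

/-- A problem that can be translated, without any change of solutions, into another one by a
computable total function on names is strongly reducible to it. -/
theorem strongReducible_of_local {X Y Z W : Type*} {f : Problem X Y} {g : Problem Z W}
    {h : Baire → Baire}
    (hc : Computable₂ fun (u : List ℕ) n => h (fun j => u[j]?.getD 0) n)
    (hl : ∀ p p' n, (∀ j < (n + 1) ^ 2, p j = p' j) → h p n = h p' n)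
    (hfg : ∀ p x, f.inRep.IsName p x → (f.toFun x).Nonempty →
      ∃ z, g.inRep.IsName (h p) z ∧ (g.toFun z).Nonempty ∧
        ∀ q, ∀ w ∈ g.toFun z, g.outRep.IsName q w → ∃ y ∈ f.toFun x, f.outRep.IsName q y) :
    StrongReducible f g := by
  refine ⟨PFun.id Baire, PFun.lift h, isComputable_id,
    isComputable_of_local hc hl, fun G hG p x hpx hx => ?_⟩
  obtain ⟨z, hz, hne, hzx⟩ := hfg p x hpx hx
  obtain ⟨q, hq, w, hw, hqw⟩ := hG _ z hz hne
  refine ⟨q, ?_, hzx q w hw hqw⟩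
  rw [PFun.comp_apply, PFun.comp_apply]
  exact Part.mem_bind (Part.mem_bind (Part.mem_some _) hq) (Part.mem_some _)

/-- Source of the quadratic bound in `isComputable_of_local`: the translations below only read pairs
of indices bounded by the output index. -/
theorem pair_lt_sq {a b n : ℕ} (ha : a ≤ n) (hb : b ≤ n) : Nat.pair a b < (n + 1) ^ 2 :=
  (Nat.pair_lt_max_add_one_sq a b).trans_le (Nat.pow_le_pow_left (by omega) 2)

/-! ### Comparison of rational codes -/

/-- A decision procedure for `ratOf u < ratOf v + c / 2 ^ k`. -/
def ratLt (u v c k : ℕ) : Bool :=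
  decide ((u.unpair.1.unpair.1 * 2 ^ k) * (v.unpair.2 + 1) +
      (v.unpair.1.unpair.2 * 2 ^ k) * (u.unpair.2 + 1) <
    (v.unpair.1.unpair.1 * 2 ^ k) * (u.unpair.2 + 1) +
      (u.unpair.1.unpair.2 * 2 ^ k) * (v.unpair.2 + 1) +
      c * ((u.unpair.2 + 1) * (v.unpair.2 + 1)))

/-- Clearing denominators and moving the subtracted terms to the other side leaves an inequality
between natural numbers. -/
theorem ratLt_iff (u v c k : ℕ) :
    ratLt u v c k = true ↔ (ratOf u : ℝ) < ratOf v + c * (1 / 2 : ℝ) ^ k := by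
  rw [ratLt, decide_eq_true_iff, ← Nat.cast_lt (α := ℝ)]
  have hu : (0 : ℝ) < (u.unpair.2 : ℝ) + 1 := by positivity
  have hv : (0 : ℝ) < (v.unpair.2 : ℝ) + 1 := by positivity
  have hk : (0 : ℝ) < 2 ^ k := by positivity
  have hm : (0 : ℝ) < ((u.unpair.2 : ℝ) + 1) * ((v.unpair.2 : ℝ) + 1) * 2 ^ k := by positivity
  simp only [ratOf]
  push_cast
  rw [← mul_lt_mul_iff_left₀ hm, one_div, inv_pow]
  field_simp
  constructor <;> intro h <;> linarith

theorem computable_ratLt (c : ℕ) {u v k : α → ℕ} (hu : Computable u) (hv : Computable v)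
    (hk : Computable k) : Computable fun a => ratLt (u a) (v a) c (k a) := by
  have h1 : Primrec fun x : ℕ => x.unpair.1.unpair.1 :=
    Primrec.fst.comp (Primrec.unpair.comp (Primrec.fst.comp Primrec.unpair))
  have h2 : Primrec fun x : ℕ => x.unpair.1.unpair.2 :=
    Primrec.snd.comp (Primrec.unpair.comp (Primrec.fst.comp Primrec.unpair))
  have h3 : Primrec fun x : ℕ => x.unpair.2 + 1 :=
    Primrec.succ.comp (Primrec.snd.comp Primrec.unpair)
  have h4 : Primrec fun x : ℕ => 2 ^ x :=
    (Primrec₂.unpaired'.1 Nat.Primrec.pow).comp (Primrec.const 2) Primrec.id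
  have pu : Primrec fun x : ℕ × ℕ × ℕ => x.1 := Primrec.fst
  have pv : Primrec fun x : ℕ × ℕ × ℕ => x.2.1 := Primrec.fst.comp Primrec.snd
  have pk : Primrec fun x : ℕ × ℕ × ℕ => x.2.2 := Primrec.snd.comp Primrec.snd
  have mul {a b : ℕ × ℕ × ℕ → ℕ} (ha : Primrec a) (hb : Primrec b) :
    Primrec fun x => a x * b x := Primrec.nat_mul.comp ha hb
  have add {a b : ℕ × ℕ × ℕ → ℕ} (ha : Primrec a) (hb : Primrec b) :
    Primrec fun x => a x + b x := Primrec.nat_add.comp ha hb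
  have hl := add (mul (mul (h1.comp pu) (h4.comp pk)) (h3.comp pv))
    (mul (mul (h2.comp pv) (h4.comp pk)) (h3.comp pu))
  have hr := add (add (mul (mul (h1.comp pv) (h4.comp pk)) (h3.comp pu))
    (mul (mul (h2.comp pu) (h4.comp pk)) (h3.comp pv)))
    (mul (Primrec.const c) (mul (h3.comp pu) (h3.comp pv)))
  have h : Primrec fun x : ℕ × ℕ × ℕ => ratLt x.1 x.2.1 c x.2.2 :=
    (Primrec.nat_lt.decide.comp hl hr).of_eq fun x => by unfold ratLt; rfl
  have hp : Computable fun a => (u a, v a, k a) := hu.pair (hv.pair hk)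
  have hc := h.to_comp.comp hp
  exact hc

end Computability

theorem computable_fst_unpair {α : Type*} [Primcodable α] {f : α → ℕ} (hf : Computable f) :
    Computable fun a => (f a).unpair.1 :=
  Computable.fst.comp (Computable.unpair.comp hf)

theorem computable_snd_unpair {α : Type*} [Primcodable α] {f : α → ℕ} (hf : Computable f) :
    Computable fun a => (f a).unpair.2 :=
  Computable.snd.comp (Computable.unpair.comp hf)

theorem computable_lookup {α : Type*} [Primcodable α] {u : α → List ℕ} {j : α → ℕ}
    (hu : Computable u) (hj : Computable j) : Computable fun a => (u a)[j a]?.getD 0 :=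
  Computable.option_getD (Computable.list_getElem?.comp hu hj) (Computable.const 0)

/-! ### The set of cluster points, given negatively in the limit -/

namespace ComputableMetricSpace

/-- Stage `i` of the search for a term `x_m`, `N ≤ m`, in the ball with number `c`, where `p` is a
name of `(x_m)` and `f` approximates the distances. -/
def meetsBall (f : ℕ × ℕ × ℕ → ℕ) (p : Baire) (c N i : ℕ) : Bool :=
  (List.range (i + 1)).any fun m => decide (N ≤ m) && (List.range (i + 1)).any fun s =>
    !ratLt c.unpair.2 (f (p (Nat.pair m s), c.unpair.1, s)) 3 s

/-- The balls from which a sequence stays away eventually, in the limit. -/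
def avoidedBalls (f : ℕ × ℕ × ℕ → ℕ) (p : Baire) : Baire := fun z =>
  bif meetsBall f p z.unpair.2.unpair.1 z.unpair.2.unpair.2 z.unpair.1 then 0
  else z.unpair.2.unpair.1

theorem computable_avoidedBalls {f : ℕ × ℕ × ℕ → ℕ} (hf : Computable f) :
    Computable₂ fun (u : List ℕ) z => avoidedBalls f (fun j => u[j]?.getD 0) z := by
  have hz : Computable fun a : List ℕ × ℕ => a.2 := Computable.snd
  have hc := computable_fst_unpair (computable_snd_unpair hz)
  have hN := computable_snd_unpair (computable_snd_unpair hz)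
  have hi := Computable.succ.comp (computable_fst_unpair hz)
  have h₁ : Computable fun b : ((List ℕ × ℕ) × ℕ) × ℕ => b.1.1 :=
    Computable.fst.comp Computable.fst
  have hp : Computable fun b : ((List ℕ × ℕ) × ℕ) × ℕ => b.1.1.1[Nat.pair b.1.2 b.2]?.getD 0 :=
    computable_lookup (Computable.fst.comp h₁)
      (Primrec₂.natPair.to_comp.comp (Computable.snd.comp Computable.fst) Computable.snd)
  have hd := hf.comp (hp.pair ((computable_fst_unpair (hc.comp h₁)).pair Computable.snd))
  have hlt := Primrec.not.to_comp.comp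
    (computable_ratLt 3 (computable_snd_unpair (hc.comp h₁)) hd Computable.snd)
  have hs := computable_any_range (hi.comp Computable.fst) hlt.to₂
  have hle : Computable fun b : (List ℕ × ℕ) × ℕ => decide (b.1.2.unpair.2.unpair.2 ≤ b.2) :=
    Primrec.nat_le.decide.to_comp.comp (hN.comp Computable.fst) Computable.snd
  have hm := computable_any_range hi (Primrec.and.to_comp.comp hle hs).to₂
  exact Computable.cond hm (Computable.const 0) hc

theorem avoidedBalls_local (f : ℕ × ℕ × ℕ → ℕ) (p p' : Baire) (z : ℕ)
    (h : ∀ j < (z + 1) ^ 2, p j = p' j) : avoidedBalls f p z = avoidedBalls f p' z := by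
  have hz := Nat.unpair_left_le z
  have key : ∀ c N, meetsBall f p c N z.unpair.1 = meetsBall f p' c N z.unpair.1 := by
    intro c N
    rw [meetsBall, meetsBall, Bool.eq_iff_iff]
    simp only [List.any_eq_true, List.mem_range, Bool.and_eq_true]
    refine exists_congr fun m => and_congr_right fun hm => and_congr_right fun _ =>
      exists_congr fun s => and_congr_right fun hs => ?_
    rw [h _ (pair_lt_sq (by omega) (by omega))]
  simp only [avoidedBalls, key]

variable {X : Type*} [MetricSpace X] (M : ComputableMetricSpace X)

theorem ratBall_zero : M.ratBall 0 = ∅ := by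
  simp [ratBall, ratOf]

theorem dist_le_of_isName {p : Baire} {x : X} (h : M.cauchyRep.IsName p x) (s : ℕ) :
    dist x (M.α (p s)) ≤ (1 / 2 : ℝ) ^ s := by
  have h1 : Tendsto (fun n => dist (M.α (p n)) (M.α (p s))) atTop (𝓝 (dist x (M.α (p s)))) :=
    h.2.dist tendsto_const_nhds
  refine le_of_tendsto h1 ?_
  filter_upwards [eventually_gt_atTop s] with n hn
  rw [dist_comm]
  exact (h.1 s n hn).le

/-- The name and the distance approximation each err by at most `2^{-s}`. A margin of `3 * 2^{-s}`
therefore proves strict membership, and the test succeeds as soon as the true slack exceeds `5 *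
2^{-s}`. -/
theorem exists_meetsBall_iff {f : ℕ × ℕ × ℕ → ℕ}
    (hf : ∀ i j k, |dist (M.α i) (M.α j) - (ratOf (f (i, j, k)) : ℝ)| ≤ (1 / 2 : ℝ) ^ k)
    {p : Baire} {x : ℕ → X} (hp : M.cauchyRep.sequences.IsName p x) (c N : ℕ) :
    (∃ i, meetsBall f p c N i = true) ↔ ∃ m ≥ N, x m ∈ M.ratBall c := by
  simp only [meetsBall, List.any_eq_true, List.mem_range, Bool.and_eq_true, decide_eq_true_eq,
    Bool.not_eq_true', ← Bool.not_eq_true, ratLt_iff, not_lt, ratBall, Metric.mem_ball]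
  constructor
  · rintro ⟨i, m, -, hm, s, -, hs⟩
    refine ⟨m, hm, ?_⟩
    have h1 := dist_le_of_isName M (hp m) s
    have h2 := (abs_le.1 (hf (p (Nat.pair m s)) c.unpair.1 s)).2
    have h3 := dist_triangle (x m) (M.α (component p m s)) (M.α c.unpair.1)
    have h4 : (0 : ℝ) < (1 / 2 : ℝ) ^ s := by positivity
    simp only [component] at h1 h3
    push_cast at hs
    linarith
  · rintro ⟨m, hm, hx⟩
    obtain ⟨s, hs⟩ := exists_pow_lt_of_lt_one (y := (1 / 2 : ℝ))
      (show (0 : ℝ) < (ratOf c.unpair.2 - dist (x m) (M.α c.unpair.1)) / 5 by linarith)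
      (by norm_num)
    refine ⟨max m s, m, by omega, hm, s, by omega, ?_⟩
    have h1 := dist_le_of_isName M (hp m) s
    have h2 := (abs_le.1 (hf (p (Nat.pair m s)) c.unpair.1 s)).1
    have h3 := dist_triangle_left (M.α (component p m s)) (M.α c.unpair.1) (x m)
    simp only [component] at h1 h3
    push_cast
    linarith

theorem meetsBall_mono {f : ℕ × ℕ × ℕ → ℕ} {p : Baire} {c N i i' : ℕ} (hi : i ≤ i')
    (h : meetsBall f p c N i = true) : meetsBall f p c N i' = true := by
  simp only [meetsBall, List.any_eq_true, List.mem_range, Bool.and_eq_true] at h ⊢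
  obtain ⟨m, hm, hN, s, hs, h⟩ := h
  exact ⟨m, by omega, hN, s, by omega, h⟩

-- A successful search stays successful at later stages, so each entry changes at most once.
open scoped Classical in
theorem isLim_avoidedBalls (f : ℕ × ℕ × ℕ → ℕ) (p : Baire) :
    IsLim (avoidedBalls f p) fun w =>
      if ∃ i, meetsBall f p w.unpair.1 w.unpair.2 i = true then 0 else w.unpair.1 := by
  rw [IsLim, tendsto_pi_nhds]
  intro w
  refine tendsto_const_nhds.congr' ?_
  split_ifs with h
  · obtain ⟨i, hi⟩ := h
    filter_upwards [eventually_ge_atTop i] with i' hi'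
    simp [component, avoidedBalls, meetsBall_mono hi' hi]
  · simp only [not_exists, Bool.not_eq_true] at h
    exact Eventually.of_forall fun i => by simp [component, avoidedBalls, h]

theorem isName_clusterSet {f : ℕ × ℕ × ℕ → ℕ}
    (hf : ∀ i j k, |dist (M.α i) (M.α j) - (ratOf (f (i, j, k)) : ℝ)| ≤ (1 / 2 : ℝ) ^ k)
    {p : Baire} {x : ℕ → X} (hp : M.cauchyRep.sequences.IsName p x) :
    M.negRep.jump.IsName (avoidedBalls f p) (clusterSet x) := by
  classical
  refine ⟨_, isLim_avoidedBalls f p, ?_⟩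
  ext y
  simp only [exists_meetsBall_iff M hf hp, Set.mem_compl_iff, Set.mem_iUnion]
  change MapClusterPt y atTop x ↔ _
  rw [mapClusterPt_iff_frequently]
  constructor
  · rintro hy ⟨w, hw⟩
    split_ifs at hw with h
    · simp [ratBall_zero] at hw
    · obtain ⟨m, hm⟩ := (frequently_atTop.1 (hy _ (Metric.isOpen_ball.mem_nhds hw))) w.unpair.2
      exact h ⟨m, hm⟩
  · intro hy s hs
    obtain ⟨c, hyc, hcs⟩ := M.exists_ratBall isOpen_interior (mem_interior_iff_mem_nhds.2 hs)
    rw [frequently_atTop]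
    intro N
    by_contra hN
    -- If the tail from `N` on avoids `c`, the entry coded by `c` and `N` stays equal to `c` and
    -- removes `y`.
    refine hy ⟨Nat.pair c N, ?_⟩
    rw [if_neg]
    · simpa using hyc
    · rintro ⟨m, hm, hxm⟩
      simp only [Nat.unpair_pair] at hm hxm
      exact hN ⟨m, hm, interior_subset (hcs hxm)⟩

theorem clusterPointProblem_strongReducible :
    StrongReducible M.clusterPointProblem M.closedChoice.jump := by
  obtain ⟨f, hfc, hf⟩ := M.computable_dist
  exact strongReducible_of_local (computable_avoidedBalls hfc) (avoidedBalls_local f)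
    fun p x hp hx => ⟨clusterSet x, isName_clusterSet M hf hp, hx, fun q w hw hq => ⟨w, hw, hq⟩⟩

/-! ### A computable sequence that clusters at the points outside the limit balls -/

/-- Membership in a `2^{-k}`-net of the dense sequence, where `f` approximates the distances. -/
def netMember (f : ℕ × ℕ × ℕ → ℕ) (k : ℕ) : ℕ → Bool :=
  greedy fun n m => ratLt (f (n, m, k + 1)) 0 1 k

theorem computable_netMember {f : ℕ × ℕ × ℕ → ℕ} (hf : Computable f) :
    Computable₂ (netMember f) := by
  have hk : Computable fun s : ℕ × ℕ × ℕ => s.1 := Computable.fst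
  have hn : Computable fun s : ℕ × ℕ × ℕ => s.2.1 := Computable.fst.comp Computable.snd
  have hm : Computable fun s : ℕ × ℕ × ℕ => s.2.2 := Computable.snd.comp Computable.snd
  have hd := hf.comp (hn.pair (hm.pair (Computable.succ.comp hk)))
  have h := computable_ratLt 1 hd (Computable.const 0) hk
  exact computable_greedy h

/-- At stage `i`, the first `k + 1` balls differ from those of the preceding stage. -/
def hasChanged (p : Baire) (k i : ℕ) : Bool :=
  (List.range (k + 1)).any fun j => !decide (p (Nat.pair i j) = p (Nat.pair (i - 1) j))

/-- The point with number `n` is outside of the first `k + 1` balls of stage `i`, once these are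
shrunk by a multiple of `2^{-k}`. -/
def avoidsBalls (f : ℕ × ℕ × ℕ → ℕ) (p : Baire) (n k i : ℕ) : Bool :=
  (List.range (k + 1)).all fun j => ratLt (p (Nat.pair i j)).unpair.2
    (f (n, (p (Nat.pair i j)).unpair.1, k)) 5 k

/-- The point with number `n` is listed at precision `2^{-k}` and stage `i`. -/
def listed (f : ℕ × ℕ × ℕ → ℕ) (p : Baire) (n k i : ℕ) : Bool :=
  netMember f k n && ((decide (i = n + k) || (decide (n + k < i) && hasChanged p k i)) &&
    avoidsBalls f p n k i)

/-- A sequence of points, given by their numbers, that clusters at the points outside of the balls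
in the limit. -/
def listing (f : ℕ × ℕ × ℕ → ℕ) (p : Baire) : ℕ → ℕ :=
  lastValue (fun t => listed f p t.unpair.1.unpair.1 t.unpair.1.unpair.2 t.unpair.2)
    fun t => t.unpair.1.unpair.1

theorem computable_listing {f : ℕ × ℕ × ℕ → ℕ} (hf : Computable f) :
    Computable₂ fun (u : List ℕ) (z : ℕ) => listing f (fun j => u[j]?.getD 0) z.unpair.1 := by
  have ht : Computable fun a : List ℕ × ℕ => a.2 := Computable.snd
  have hn := computable_fst_unpair (computable_fst_unpair ht)
  have hk := computable_snd_unpair (computable_fst_unpair ht)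
  have hi := computable_snd_unpair ht
  have h₁ : Computable fun b : (List ℕ × ℕ) × ℕ => b.1 := Computable.fst
  have hp : Computable fun b : (List ℕ × ℕ) × ℕ => b.1.1[Nat.pair b.1.2.unpair.2 b.2]?.getD 0 :=
    computable_lookup (Computable.fst.comp h₁)
      (Primrec₂.natPair.to_comp.comp (hi.comp h₁) Computable.snd)
  have hp' : Computable fun b : (List ℕ × ℕ) × ℕ =>
      b.1.1[Nat.pair (b.1.2.unpair.2 - 1) b.2]?.getD 0 :=
    computable_lookup (Computable.fst.comp h₁)
      (Primrec₂.natPair.to_comp.comp (Computable.pred.comp (hi.comp h₁)) Computable.snd)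
  have hne := Primrec.not.to_comp.comp ((Primrec.eq (α := ℕ)).decide.to_comp.comp hp hp')
  have hchanged := computable_any_range (Computable.succ.comp hk) hne.to₂
  have hd := hf.comp ((hn.comp h₁).pair ((computable_fst_unpair hp).pair (hk.comp h₁)))
  have hlt := computable_ratLt 5 (computable_snd_unpair hp) hd (hk.comp h₁)
  have havoids := computable_all_range (Computable.succ.comp hk) hlt.to₂
  have hnk := Primrec.nat_add.to_comp.comp hn hk
  have heq := (Primrec.eq (α := ℕ)).decide.to_comp.comp hi hnk
  have hgt := Primrec.nat_lt.decide.to_comp.comp hnk hi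
  have hlisted := Primrec.and.to_comp.comp ((computable_netMember hf).comp hk hn)
    (Primrec.and.to_comp.comp
      (Primrec.or.to_comp.comp heq (Primrec.and.to_comp.comp hgt hchanged)) havoids)
  have hv : Computable fun t : ℕ => t.unpair.1.unpair.1 :=
    computable_fst_unpair (computable_fst_unpair Computable.id)
  have h := computable_lastValue (P := fun (u : List ℕ) t =>
    listed f (fun j => u[j]?.getD 0) t.unpair.1.unpair.1 t.unpair.1.unpair.2 t.unpair.2) hlisted hv
  exact h.comp Computable.fst (computable_fst_unpair Computable.snd)

theorem listing_local (f : ℕ × ℕ × ℕ → ℕ) (p p' : Baire) (z : ℕ)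
    (h : ∀ j < (z + 1) ^ 2, p j = p' j) :
    listing f p z.unpair.1 = listing f p' z.unpair.1 := by
  refine lastValue_congr fun t ht => ?_
  have hz := Nat.unpair_left_le z
  have h1 := Nat.unpair_left_le t
  have h2 := Nat.unpair_right_le t
  have h3 := Nat.unpair_right_le t.unpair.1
  have hp : ∀ j ∈ List.range (t.unpair.1.unpair.2 + 1),
      p (Nat.pair t.unpair.2 j) = p' (Nat.pair t.unpair.2 j) ∧
      p (Nat.pair (t.unpair.2 - 1) j) = p' (Nat.pair (t.unpair.2 - 1) j) := fun j hj => by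
    rw [List.mem_range] at hj
    exact ⟨h _ (pair_lt_sq (by omega) (by omega)), h _ (pair_lt_sq (by omega) (by omega))⟩
  have hc : hasChanged p t.unpair.1.unpair.2 t.unpair.2 =
      hasChanged p' t.unpair.1.unpair.2 t.unpair.2 := by
    rw [hasChanged, hasChanged, Bool.eq_iff_iff, List.any_eq_true, List.any_eq_true]
    exact exists_congr fun j => and_congr_right fun hj => by rw [(hp j hj).1, (hp j hj).2]
  have ha : avoidsBalls f p t.unpair.1.unpair.1 t.unpair.1.unpair.2 t.unpair.2 =
      avoidsBalls f p' t.unpair.1.unpair.1 t.unpair.1.unpair.2 t.unpair.2 := by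
    rw [avoidsBalls, avoidsBalls, Bool.eq_iff_iff, List.all_eq_true, List.all_eq_true]
    exact forall₂_congr fun j hj => by rw [(hp j hj).1]
  rw [listed, listed, hc, ha]

/-! ### Cluster points of the listing -/

theorem eventually_forall_le_eq {p q : Baire} (h : IsLim p q) (k : ℕ) :
    ∃ i₀, ∀ i ≥ i₀, ∀ j ≤ k, p (Nat.pair i j) = q j := by
  have h' : ∀ j, ∀ᶠ i in atTop, p (Nat.pair i j) = q j := fun j => by
    simpa [component] using (tendsto_pi_nhds.1 h j)
  have := (Set.finite_Iic k).eventually_all.2 fun j _ => h' j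
  exact eventually_atTop.1 this

theorem le_of_listed {f : ℕ × ℕ × ℕ → ℕ} {p : Baire} {n k i : ℕ}
    (h : listed f p n k i = true) : n + k ≤ i := by
  simp only [listed, Bool.and_eq_true, Bool.or_eq_true, decide_eq_true_eq] at h
  omega

/-- After stage `i₀` the relevant balls no longer change, so only the initial listing at `n + k` can
still occur. -/
theorem le_max_of_listed {f : ℕ × ℕ × ℕ → ℕ} {p q : Baire} {n k i i₀ : ℕ}
    (h₀ : ∀ i ≥ i₀, ∀ j ≤ k, p (Nat.pair i j) = q j) (h : listed f p n k i = true) :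
    i ≤ max (n + k) i₀ := by
  simp only [listed, hasChanged, Bool.and_eq_true, Bool.or_eq_true, decide_eq_true_eq,
    List.any_eq_true, List.mem_range, Bool.not_eq_true', decide_eq_false_iff_not] at h
  by_contra! hi
  rw [max_lt_iff] at hi
  obtain ⟨-, h | ⟨-, j, hj, hne⟩, -⟩ := h
  · omega
  · exact hne ((h₀ i (by omega) j (by omega)).trans (h₀ (i - 1) (by omega) j (by omega)).symm)

/-- Selected points have approximate distance at least `2^{-k}`, with error at most `2^{-(k+1)}`. -/
theorem netMember_separated {f : ℕ × ℕ × ℕ → ℕ}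
    (hf : ∀ i j k, |dist (M.α i) (M.α j) - (ratOf (f (i, j, k)) : ℝ)| ≤ (1 / 2 : ℝ) ^ k)
    {k n m : ℕ} (hn : netMember f k n = true) (hm : netMember f k m = true)
    (h : dist (M.α n) (M.α m) < (1 / 2 : ℝ) ^ (k + 1)) : n = m := by
  wlog hlt : m < n generalizing n m
  · rcases (not_lt.1 hlt).lt_or_eq with h' | h'
    · exact (this hm hn (by rwa [dist_comm]) h').symm
    · exact h'
  have h1 := (greedy_iff _ _).1 hn m hlt hm
  rw [← Bool.not_eq_true, ratLt_iff] at h1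
  have h2 := (abs_le.1 (hf n m (k + 1))).1
  have h0 : (ratOf 0 : ℝ) = 0 := by simp [ratOf]
  rw [h0] at h1
  push_cast at h1
  rw [pow_succ] at h h2
  linarith

/-- A dense point within `2^{-k}` of `x` is either selected or rejected because of a selected point
within `2^{-k} + 2^{-(k+1)}` of it. -/
theorem exists_netMember {f : ℕ × ℕ × ℕ → ℕ}
    (hf : ∀ i j k, |dist (M.α i) (M.α j) - (ratOf (f (i, j, k)) : ℝ)| ≤ (1 / 2 : ℝ) ^ k)
    (x : X) (k : ℕ) : ∃ n, netMember f k n = true ∧ dist x (M.α n) < 3 * (1 / 2 : ℝ) ^ k := by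
  have hk : (0 : ℝ) < (1 / 2 : ℝ) ^ k := by positivity
  obtain ⟨n, hn⟩ := M.dense.exists_dist_lt x hk
  by_cases h : netMember f k n = true
  · exact ⟨n, h, by linarith⟩
  · rw [netMember, greedy_iff] at h
    push Not at h
    obtain ⟨m, -, hm, hnm⟩ := h
    rw [ne_eq, Bool.not_eq_false, ratLt_iff] at hnm
    refine ⟨m, hm, ?_⟩
    have h2 := (abs_le.1 (hf n m (k + 1))).2
    have h0 : (ratOf 0 : ℝ) = 0 := by simp [ratOf]
    have h3 := dist_triangle x (M.α n) (M.α m)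
    rw [h0] at hnm
    push_cast at hnm
    rw [pow_succ] at h2
    linarith

/-- Take the least stage from `n + k` on that shows the final first `k + 1` balls. If it is not `n +
k` itself, minimality forces a change from the preceding stage. The test is passed because `3 *
2^{-k}` for the net and `2^{-k}` for `f` stay below `5 * 2^{-k}`. -/
theorem exists_listed {f : ℕ × ℕ × ℕ → ℕ}
    (hf : ∀ i j k, |dist (M.α i) (M.α j) - (ratOf (f (i, j, k)) : ℝ)| ≤ (1 / 2 : ℝ) ^ k)
    {p q : Baire} (hpq : IsLim p q) {x : X} (hx : ∀ j, x ∉ M.ratBall (q j)) (k : ℕ) :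
    ∃ n i, listed f p n k i = true ∧ dist x (M.α n) < 3 * (1 / 2 : ℝ) ^ k := by
  obtain ⟨n, hn, hxn⟩ := exists_netMember M hf x k
  obtain ⟨i₀, hi₀⟩ := eventually_forall_le_eq hpq k
  have hex : ∃ i, n + k ≤ i ∧ ∀ j ≤ k, p (Nat.pair i j) = q j :=
    ⟨max (n + k) i₀, le_max_left _ _, hi₀ _ (le_max_right _ _)⟩
  classical
  obtain ⟨hle, heq⟩ := Nat.find_spec hex
  refine ⟨n, Nat.find hex, ?_, hxn⟩
  simp only [listed, hasChanged, avoidsBalls, Bool.and_eq_true, Bool.or_eq_true,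
    decide_eq_true_eq, List.any_eq_true, List.all_eq_true, List.mem_range, Bool.not_eq_true',
    decide_eq_false_iff_not]
  refine ⟨hn, ?_, fun j hj => ?_⟩
  · rcases hle.eq_or_lt with h | h
    · exact Or.inl h.symm
    · refine Or.inr ⟨h, ?_⟩
      by_contra! hcon
      refine Nat.find_min hex (m := Nat.find hex - 1) (by omega) ⟨by omega, fun j hj => ?_⟩
      rw [← hcon j (by omega), heq j hj]
  · rw [heq j (by omega), ratLt_iff]
    have h1 := (abs_le.1 (hf n (q j).unpair.1 k)).2
    have h2 := hx j
    simp only [ratBall, Metric.mem_ball, not_lt] at h2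
    have h3 := dist_triangle x (M.α n) (M.α (q j).unpair.1)
    have hk : (0 : ℝ) < (1 / 2 : ℝ) ^ k := by positivity
    push_cast
    linarith

theorem lt_dist_of_listed {f : ℕ × ℕ × ℕ → ℕ}
    (hf : ∀ i j k, |dist (M.α i) (M.α j) - (ratOf (f (i, j, k)) : ℝ)| ≤ (1 / 2 : ℝ) ^ k)
    {p : Baire} {n k i j : ℕ} (h : listed f p n k i = true) (hj : j ≤ k) :
    (ratOf (p (Nat.pair i j)).unpair.2 : ℝ) <
      dist (M.α n) (M.α (p (Nat.pair i j)).unpair.1) + 6 * (1 / 2 : ℝ) ^ k := by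
  simp only [listed, avoidsBalls, Bool.and_eq_true, List.all_eq_true, List.mem_range] at h
  have h1 := (ratLt_iff _ _ _ _).1 (h.2.2 j (by omega))
  have h2 := (abs_le.1 (hf n (p (Nat.pair i j)).unpair.1 k)).1
  push_cast at h1
  linarith

theorem exists_bound_of_mem_ratBall {f : ℕ × ℕ × ℕ → ℕ}
    (hf : ∀ i j k, |dist (M.α i) (M.α j) - (ratOf (f (i, j, k)) : ℝ)| ≤ (1 / 2 : ℝ) ^ k)
    {p q : Baire} (hpq : IsLim p q) {x : X} {j : ℕ} (hx : x ∈ M.ratBall (q j)) :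
    ∃ U ∈ 𝓝 x, ∃ B, ∀ n k i, listed f p n k i = true → M.α n ∈ U → i ≤ B := by
  simp only [ratBall, Metric.mem_ball] at hx
  -- The slack `7 * 2^{-K}` covers the `6 * 2^{-k}` of `lt_dist_of_listed` for `k ≥ K` and the
  -- radius `2^{-(K+1)}` of the neighbourhood.
  obtain ⟨K₀, hK₀⟩ := exists_pow_lt_of_lt_one (y := (1 / 2 : ℝ))
    (show (0 : ℝ) < (ratOf (q j).unpair.2 - dist x (M.α (q j).unpair.1)) / 7 by linarith)
    (by norm_num)
  obtain ⟨K, hjK, hK⟩ : ∃ K ≥ j, (1 / 2 : ℝ) ^ K <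
      (ratOf (q j).unpair.2 - dist x (M.α (q j).unpair.1)) / 7 :=
    ⟨max j K₀, le_max_left _ _,
      (pow_le_pow_of_le_one (by norm_num) (by norm_num) (le_max_right _ _)).trans_lt hK₀⟩
  have hpos : (0 : ℝ) < (1 / 2 : ℝ) ^ (K + 1) := by positivity
  have hanti : ∀ {a b : ℕ}, a ≤ b → (1 / 2 : ℝ) ^ b ≤ (1 / 2 : ℝ) ^ a := fun h =>
    pow_le_pow_of_le_one (by norm_num) (by norm_num) h
  have hU := Metric.ball_mem_nhds x hpos
  refine ⟨_, hU, ?_⟩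
  obtain ⟨i₀, hi₀⟩ := eventually_forall_le_eq hpq K
  -- For `k < K` the test may be too coarse to exclude anything, but two net points in this ball are
  -- closer than `2^{-K} ≤ 2^{-(k+1)}` and hence coincide.
  have hbound : ∀ k, ∃ b, k < K → ∀ n, netMember f k n = true →
      M.α n ∈ Metric.ball x ((1 / 2 : ℝ) ^ (K + 1)) → n ≤ b := by
    intro k
    by_cases hm : ∃ m, netMember f k m = true ∧ M.α m ∈ Metric.ball x ((1 / 2 : ℝ) ^ (K + 1))
    · obtain ⟨m, hm, hmx⟩ := hm
      refine ⟨m, fun hk n hn hnx => (netMember_separated M hf hn hm ?_).le⟩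
      rw [Metric.mem_ball] at hmx hnx
      have h1 := dist_triangle_right (M.α n) (M.α m) x
      have h2 : (1 / 2 : ℝ) ^ K ≤ (1 / 2 : ℝ) ^ (k + 1) := hanti hk
      rw [pow_succ] at hmx hnx
      linarith
    · exact ⟨0, fun _ n hn hnx => (hm ⟨n, hn, hnx⟩).elim⟩
  choose b hb using hbound
  refine ⟨(∑ k ∈ Finset.range K, b k) + K + i₀, fun n k i h hn => ?_⟩
  rcases lt_or_ge k K with hk | hk
  · have h1 : n ≤ b k := hb k hk n
      (by simp only [listed, Bool.and_eq_true] at h; exact h.1) hn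
    have h2 : b k ≤ ∑ k ∈ Finset.range K, b k :=
      Finset.single_le_sum (fun _ _ => Nat.zero_le _) (Finset.mem_range.2 hk)
    have h3 := le_max_of_listed (fun i hi j hj => hi₀ i hi j (by omega)) h
    omega
  · by_contra! hi
    have h1 := lt_dist_of_listed M hf h (hjK.trans hk)
    rw [hi₀ i (by omega) j hjK] at h1
    rw [Metric.mem_ball] at hn
    have h2 := dist_triangle (M.α n) x (M.α (q j).unpair.1)
    have h3 : (1 / 2 : ℝ) ^ k ≤ (1 / 2 : ℝ) ^ K := hanti hk
    have h4 : (1 / 2 : ℝ) ^ (K + 1) ≤ (1 / 2 : ℝ) ^ K := hanti (Nat.le_succ K)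
    linarith

theorem mapClusterPt_listing {f : ℕ × ℕ × ℕ → ℕ}
    (hf : ∀ i j k, |dist (M.α i) (M.α j) - (ratOf (f (i, j, k)) : ℝ)| ≤ (1 / 2 : ℝ) ^ k)
    {p q : Baire} (hpq : IsLim p q) {x : X} (hx : ∀ j, x ∉ M.ratBall (q j)) :
    MapClusterPt x atTop fun t => M.α (listing f p t) := by
  rw [mapClusterPt_iff_frequently]
  intro s hs
  obtain ⟨ε, hε, hεs⟩ := Metric.mem_nhds_iff.1 hs
  rw [frequently_atTop]
  intro N
  obtain ⟨K, hK⟩ := exists_pow_lt_of_lt_one (y := (1 / 2 : ℝ))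
    (show (0 : ℝ) < ε / 3 by linarith) (by norm_num)
  obtain ⟨n, i, h, hxn⟩ := exists_listed M hf hpq hx (max N K)
  have h1 : (1 / 2 : ℝ) ^ max N K ≤ (1 / 2 : ℝ) ^ K :=
    pow_le_pow_of_le_one (by norm_num) (by norm_num) (le_max_right _ _)
  refine ⟨Nat.pair (Nat.pair n (max N K)) i, ?_, hεs ?_⟩
  · have := le_of_listed h
    have := Nat.right_le_pair (Nat.pair n (max N K)) i
    omega
  · rw [listing, lastValue_of_eq_true (by simpa using h)]
    simp only [Nat.unpair_pair, Metric.mem_ball]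
    rw [dist_comm]
    linarith

/-- Between listings the last value is repeated, so finitely many listings near `x` could still
produce a cluster point if the listing ever stopped. The point `x₀` rules this out: it causes
listings at arbitrarily high precision. -/
theorem notMem_ratBall_of_mapClusterPt_listing {f : ℕ × ℕ × ℕ → ℕ}
    (hf : ∀ i j k, |dist (M.α i) (M.α j) - (ratOf (f (i, j, k)) : ℝ)| ≤ (1 / 2 : ℝ) ^ k)
    {p q : Baire} (hpq : IsLim p q) {x₀ : X} (hx₀ : ∀ j, x₀ ∉ M.ratBall (q j)) {x : X}
    (hx : MapClusterPt x atTop fun t => M.α (listing f p t)) (j : ℕ) :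
    x ∉ M.ratBall (q j) := by
  intro hxj
  obtain ⟨U, hU, B, hB⟩ := exists_bound_of_mem_ratBall M hf hpq hxj
  -- Since `n + k ≤ i ≤ B` for every listing in `U`, `T` bounds the times of all of them. A listing
  -- at precision `T + 1` happens after `T` and overwrites them for good.
  let T := (Finset.range (B + 1) ×ˢ Finset.range (B + 1) ×ˢ Finset.range (B + 1)).sup
    fun a => Nat.pair (Nat.pair a.1 a.2.1) a.2.2
  obtain ⟨n, i, h, -⟩ := exists_listed M hf hpq hx₀ (T + 1)
  obtain ⟨t, ht, htU⟩ := frequently_atTop.1 (mapClusterPt_iff_frequently.1 hx U hU)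
    (Nat.pair (Nat.pair n (T + 1)) i)
  obtain ⟨t', hle, ht', heq⟩ := exists_lastValue_eq
    (P := fun t => listed f p t.unpair.1.unpair.1 t.unpair.1.unpair.2 t.unpair.2)
    (v := fun t => t.unpair.1.unpair.1) (by simpa using h) ht
  rw [listing, heq] at htU
  have h1 := hB _ _ _ ht' htU
  have h2 := le_of_listed ht'
  have h3 : t' ≤ T := by
    have := Finset.le_sup (f := fun a : ℕ × ℕ × ℕ => Nat.pair (Nat.pair a.1 a.2.1) a.2.2)
      (s := Finset.range (B + 1) ×ˢ Finset.range (B + 1) ×ˢ Finset.range (B + 1))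
      (b := (t'.unpair.1.unpair.1, t'.unpair.1.unpair.2, t'.unpair.2))
      (by simp only [Finset.mem_product, Finset.mem_range]; omega)
    simpa using this
  have h4 := Nat.right_le_pair n (T + 1)
  have h5 := Nat.left_le_pair (Nat.pair n (T + 1)) i
  omega

theorem isName_const (n : ℕ) : M.cauchyRep.IsName (fun _ => n) (M.α n) :=
  ⟨fun k _ _ => by rw [dist_self]; positivity, tendsto_const_nhds⟩

theorem closedChoice_jump_strongReducible :
    StrongReducible M.closedChoice.jump M.clusterPointProblem := by
  obtain ⟨f, hfc, hf⟩ := M.computable_dist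
  refine strongReducible_of_local (h := fun p z => listing f p z.unpair.1)
    (computable_listing hfc) (listing_local f) fun p A hp hA => ?_
  obtain ⟨q, hpq, hq⟩ := hp
  have hmem : ∀ x, x ∈ A ↔ ∀ j, x ∉ M.ratBall (q j) := fun x => by
    rw [← SetLike.mem_coe, show (A : Set X) = _ from hq]
    simp
  obtain ⟨x₀, hx₀⟩ := hA
  have hx₀' := (hmem x₀).1 hx₀
  refine ⟨fun t => M.α (listing f p t), fun t => ?_,
    ⟨x₀, mapClusterPt_listing M hf hpq hx₀'⟩, fun r x hx hr => ⟨x, ?_, hr⟩⟩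
  -- The terms belong to the dense sequence, so constant sequences serve as their Cauchy names.
  · have : component (fun z => listing f p z.unpair.1) t = fun _ => listing f p t := by
      funext s
      simp [component]
    rw [this]
    exact isName_const M _
  · exact (hmem x).2 (notMem_ratBall_of_mapClusterPt_listing M hf hpq hx₀' hx)

end ComputableMetricSpace

end Weihrauch

theorem mainTheorem1 {X : Type*} [MetricSpace X] (M : Weihrauch.ComputableMetricSpace X) :
    Weihrauch.StrongEquivalent M.closedChoice.jump M.clusterPointProblem :=
  ⟨M.closedChoice_jump_strongReducible, M.clusterPointProblem_strongReducible⟩
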